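/- All graphs are finite, simple and undirected, with nonempty vertex set. A \emph{fort} of a graph $G$ is a nonempty set $F\subseteq V(G)$ such that no vertex $v\in V(G)\setminus F$ has exactly one neighbor in $F$. A set $S\subseteq V(G)$ is a \emph{ZIr-set} if for every $x\in S$ there is a fort $F$ of $G$ with $S\cap F=\{x\}$. Let $\operatorname{zir}(G)$ denote the minimum cardinality of a ZIr-set that is maximal with respect to inclusion. Write $\overline G$ for the complement of $G$, $\sqcup$ for disjoint union, $\vee$ for join, $K_r$ for the complete graph on $r$ vertices ($K_0$ is the empty graph with no vertices), and $K_{q,p}$ for the complete bipartite graph with parts of sizes $q$ and $p$ (so $K_{0,p}$ consists of $p$ isolated vertices). \textbf{Theorem.} Let $G$ be a graph of order $n\ge 3$. Then $\operatorname{zir}(G)=n-2$ if and only if \[ \overline G\cong\left(K_{q_1,p_1}\sqcup K_{q_2,p_2}\sqcup\cdots\sqcup K_{q_k,p_k}\right)\vee K_r \] for some integers $k\ge 1$, $r\ge 0$, $p_1,\dots,p_k$ and $q_1,\dots,q_k$ with $p_i\ge q_i$ and $p_i\ge 1$ for $1\le i\le k$, $q_i\ge q_{i+1}$ for $1\le i\le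 k-1$, $q_{k-1}\ge 1$ if $k\ge 2$, $q_k\ge 0$, and \[ q_1\ge 2\quad\text{or}\quad (q_1=1\text{ and }k\ge 2). \] -/

import Mathlib

namespace ZeroForcing

/-- A fort of `G`: a nonempty set `F` of vertices such that no vertex outside `F` has exactly one
neighbour in `F`. -/
def IsFort {V : Type*} (G : SimpleGraph V) (F : Set V) : Prop :=
  F.Nonempty ∧ ∀ v, v ∉ F → (F ∩ G.neighborSet v).ncard ≠ 1

/-- `F` is a private fort of `x` relative to `S`. -/
def IsPrivateFort {V : Type*} (G : SimpleGraph V) (S : Set V) (x : V) (F : Set V) : Prop :=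
  IsFort G F ∧ S ∩ F = {x}

/-- A Z-irredundant set: every element has a private fort. -/
def IsZIrSet {V : Type*} (G : SimpleGraph V) (S : Set V) : Prop :=
  ∀ x ∈ S, ∃ F : Set V, IsPrivateFort G S x F

/-- The lower ZIr number: the least cardinality of an inclusion-maximal Z-irredundant set.
Since `∅` is a Z-irredundant set, every finite graph has a maximal one
(see `exists_maximal_isZIrSet`), so this infimum is a minimum. -/
noncomputable def zir {V : Type*} (G : SimpleGraph V) : ℕ :=
  sInf {m : ℕ | ∃ S : Set V, Maximal (IsZIrSet G) S ∧ S.ncard = m}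

theorem exists_maximal_isZIrSet {V : Type*} [Finite V] (G : SimpleGraph V) :
    ∃ S : Set V, Maximal (IsZIrSet G) S :=
  (Set.toFinite {S : Set V | IsZIrSet G S}).exists_maximal ⟨∅, fun _ hx => hx.elim⟩

/-- The disjoint union of an indexed family of graphs. -/
def disjointUnion {ι : Type*} {W : ι → Type*} (H : ∀ i, SimpleGraph (W i)) :
    SimpleGraph (Σ i, W i) where
  Adj a b := ∃ (i : ι) (x y : W i), (H i).Adj x y ∧ a = ⟨i, x⟩ ∧ b = ⟨i, y⟩
  symm := ⟨by
    rintro a b ⟨i, x, y, h, ha, hb⟩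
    exact ⟨i, y, x, h.symm, hb, ha⟩⟩
  loopless := ⟨by
    rintro a ⟨i, x, y, h, ha, hb⟩
    have hxy : x = y := eq_of_heq (Sigma.mk.inj (ha.symm.trans hb)).2
    exact h.ne hxy⟩

/-- The join of two disjoint graphs: their disjoint union together with all edges between
the two vertex sets. -/
def join {V W : Type*} (G : SimpleGraph V) (H : SimpleGraph W) : SimpleGraph (V ⊕ W) :=
  (G ⊕g H) ⊔ completeBipartiteGraph V W

/-- The graph `(K_{q₁,p₁} ⊔ ⋯ ⊔ K_{q_k,p_k}) ∨ K_r`; the indices run from `0` to `k - 1`. -/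
def bipartiteUnionJoin {k : ℕ} (q p : Fin k → ℕ) (r : ℕ) :
    SimpleGraph ((Σ i : Fin k, Fin (q i) ⊕ Fin (p i)) ⊕ Fin r) :=
  join (disjointUnion fun i => completeBipartiteGraph (Fin (q i)) (Fin (p i)))
    (SimpleGraph.completeGraph (Fin r))

end ZeroForcing

/-!
Write `n` for the order of `G`, and call the pairs of distinct nonadjacent vertices of `G` its
nonedges. Isolated vertices of `G` lie in every maximal Z-irredundant set and correspond to the
dominating vertices `K_r` of the complement, so everything happens on `G.support`, the set of
non-isolated vertices. The theorem is proved through the intermediate criterion `zir_eq_iff`: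
`zir G = n - 2` if and only if

* `CompletesWalks G`: the ends of every walk of three nonedges in the support form a nonedge, and
* there is a nonedge in the support.

*Necessity.* A minimal transversal of the forts is a maximal Z-irredundant set
(`maximal_isZIrSet_of_minimal`), so `n - 2 ≤ zir G` forces every three vertices to contain a fort.
A fort of size one is an isolated vertex, and a fort consisting of two non-isolated vertices is a
pair of twins; this excludes induced paths on four vertices and makes all independent triples in the
support consist of twins (`TriplesContainForts.adj_iff_of_independent`). If there were such a
triple, the complement of its twin class would be a maximal Z-irredundant set with at most `n - 3`
elements (`TriplesContainForts.not_independent`). Without independent triples and induced paths on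
four vertices, walks of three nonedges are completed. If the support had no nonedge, it would be a
clique of twins, and a Z-irredundant set missing two of its vertices could be enlarged by either of
them (`exists_compl_adj_of_zir_eq`).

*Sufficiency.* Two vertices `a`, `b` of the support without a common non-neighbour have a
Z-irredundant complement (`CompletesWalks.isZIrSet_compl_pair`): a non-isolated `x` has the private
fort `{x, a, b}`, `{x, a}` or `{x, b}`. Hence the vertices missed by a maximal Z-irredundant set, if
there are three or more, have one common non-neighbour `c`, and then no neighbour of `c` has a private
fort (`CompletesWalks.not_three_missing`). A Z-irredundant set missing at most one vertex would turn
the support into a clique (`not_isZIrSet_compl_singleton`).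

*Structure.* A graph in which the ends of every three-edge walk are adjacent is a disjoint union of
complete bipartite graphs, its isolated vertices forming one piece with an empty side
(`exists_bipartition`). Applied to the nonedges in the support, with the pieces sorted by the size
of the smaller side, this yields the sizes `q i ≤ p i`; the condition on `q 0` says that the pieces
contain a nonedge and that none of their vertices is isolated in `G`. The isomorphism exists because both
graphs are determined by the sizes of their parts (`nonempty_iso_of_label`).
-/

namespace ZeroForcing

variable {V : Type*} {G : SimpleGraph V}

/-! ### Forts and Z-irredundant sets -/

theorem isFort_iff {F : Set V} :
    IsFort G F ↔ F.Nonempty ∧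
      ∀ v, v ∉ F → ∀ x ∈ F, G.Adj v x → ∃ y ∈ F, y ≠ x ∧ G.Adj v y := by
  refine and_congr_right fun _ => forall₂_congr fun v _ => ?_
  rw [Ne, Set.ncard_eq_one]
  constructor
  · intro h x hx hvx
    by_contra! hy
    exact h ⟨x, Set.Subset.antisymm
      (fun y hyF => by_contra fun hne => hy y hyF.1 hne hyF.2)
      (Set.singleton_subset_iff.2 ⟨hx, hvx⟩)⟩
  · rintro h ⟨x, hx⟩
    have hxm : x ∈ F ∩ G.neighborSet v := hx ▸ rfl
    obtain ⟨y, hy, hyx, hvy⟩ := h x hxm.1 hxm.2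
    have hym : y ∈ F ∩ G.neighborSet v := ⟨hy, hvy⟩
    rw [hx] at hym
    exact hyx hym

theorem IsFort.exists_adj_ne {F : Set V} (hF : IsFort G F) {v x : V} (hv : v ∉ F) (hx : x ∈ F)
    (hvx : G.Adj v x) : ∃ y ∈ F, y ≠ x ∧ G.Adj v y :=
  (isFort_iff.1 hF).2 v hv x hx hvx

theorem isFort_singleton {x : V} (hx : x ∉ G.support) : IsFort G {x} := by
  refine isFort_iff.2 ⟨Set.singleton_nonempty x, ?_⟩
  rintro v - y rfl hv
  exact (hx ⟨v, hv.symm⟩).elim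

theorem IsZIrSet.mono {S T : Set V} (hT : IsZIrSet G T) (hST : S ⊆ T) : IsZIrSet G S := by
  intro x hx
  obtain ⟨F, hF, hTF⟩ := hT x (hST hx)
  refine ⟨F, hF, Set.Subset.antisymm
    ((Set.inter_subset_inter_left F hST).trans hTF.subset) ?_⟩
  rintro y rfl
  exact ⟨hx, (hTF.symm.subset rfl).2⟩

theorem isZIrSet_iff {S : Set V} :
    IsZIrSet G S ↔ ∀ x ∈ S, ∃ F, IsFort G F ∧ x ∈ F ∧ ∀ y ∈ F, y ∈ S → y = x := by
  refine forall₂_congr fun x hx => exists_congr fun F => and_congr_right fun _ => ?_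
  constructor
  · intro h
    exact ⟨(h.symm.subset rfl).2, fun y hy hyS => h.subset ⟨hyS, hy⟩⟩
  · rintro ⟨hxF, h⟩
    refine Set.Subset.antisymm (fun y hy => h y hy.2 hy.1) ?_
    rintro y rfl
    exact ⟨hx, hxF⟩

/-- Deleting isolated vertices from a private fort leaves a fort, so a maximal Z-irredundant set
contains every isolated vertex. -/
theorem IsZIrSet.union_compl_support {S : Set V} (hS : IsZIrSet G S) :
    IsZIrSet G (S ∪ G.supportᶜ) := by
  rw [isZIrSet_iff] at hS ⊢
  intro x hx
  by_cases hxU : x ∈ G.support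
  · obtain ⟨F, hF, hxF, hFS⟩ := hS x (hx.resolve_right fun h => h hxU)
    refine ⟨F ∩ G.support, isFort_iff.2 ⟨⟨x, hxF, hxU⟩, ?_⟩, ⟨hxF, hxU⟩, ?_⟩
    · intro v hv y hy hvy
      obtain ⟨z, hz, hzy, hvz⟩ := hF.exists_adj_ne (fun h => hv ⟨h, y, hvy⟩) hy.1 hvy
      exact ⟨z, ⟨hz, v, hvz.symm⟩, hzy, hvz⟩
    · exact fun y hy hyS => hFS y hy.1 (hyS.resolve_right fun h => h hy.2)
  · exact ⟨{x}, isFort_singleton hxU, rfl, fun y hy _ => hy⟩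

theorem mem_support_of_notMem_maximal {S : Set V} (hS : Maximal (IsZIrSet G) S) {x : V}
    (hx : x ∉ S) : x ∈ G.support := by
  by_contra hxU
  exact hx (hS.2 hS.1.union_compl_support Set.subset_union_left (.inr hxU))

theorem zir_le {S : Set V} (hS : Maximal (IsZIrSet G) S) : zir G ≤ S.ncard :=
  Nat.sInf_le ⟨S, hS, rfl⟩

theorem exists_ncard_eq_zir [Finite V] (G : SimpleGraph V) :
    ∃ S : Set V, Maximal (IsZIrSet G) S ∧ S.ncard = zir G :=
  Nat.sInf_mem (s := {m : ℕ | ∃ S : Set V, Maximal (IsZIrSet G) S ∧ S.ncard = m})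
    (let ⟨S, hS⟩ := exists_maximal_isZIrSet G; ⟨_, S, hS, rfl⟩)

/-- A minimal transversal of the forts (a minimal zero forcing set) is a maximal Z-irredundant
set: minimality gives each element a private fort, and a new element has none. -/
theorem maximal_isZIrSet_of_minimal {S : Set V}
    (hS : Minimal (fun S : Set V => ∀ F, IsFort G F → (S ∩ F).Nonempty) S) :
    Maximal (IsZIrSet G) S := by
  refine ⟨isZIrSet_iff.2 fun x hx => ?_, fun T hT hST x hxT => ?_⟩
  · have h : ¬ ∀ F, IsFort G F → ((S \ {x}) ∩ F).Nonempty := fun h =>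
      (hS.2 h Set.sdiff_subset hx).2 rfl
    push Not at h
    obtain ⟨F, hF, hFe⟩ := h
    have hFx : ∀ y ∈ F, y ∈ S → y = x := fun y hy hyS => by_contra fun hne =>
      Set.eq_empty_iff_forall_notMem.1 hFe y ⟨⟨hyS, hne⟩, hy⟩
    obtain ⟨y, hyS, hyF⟩ := hS.1 F hF
    exact ⟨F, hF, hFx y hyF hyS ▸ hyF, hFx⟩
  · obtain ⟨F, hF, -, hFT⟩ := isZIrSet_iff.1 hT x hxT
    obtain ⟨y, hyS, hyF⟩ := hS.1 F hF
    exact hFT y hyF (hST hyS) ▸ hyS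

/-- If no maximal Z-irredundant set misses three vertices, then neither does any transversal of
the forts: every three vertices contain a fort. -/
theorem exists_isFort_subset_triple [Fintype V] (hz : Fintype.card V - 2 ≤ zir G) {a b c : V}
    (hab : a ≠ b) (hac : a ≠ c) (hbc : b ≠ c) : ∃ F ⊆ {a, b, c}, IsFort G F := by
  by_contra! h
  obtain ⟨S, hSs, hS⟩ := (Set.toFinite {S : Set V | ∀ F, IsFort G F → (S ∩ F).Nonempty}
    ).exists_le_minimal (a := {a, b, c}ᶜ) (fun F hF => by
      by_contra hne
      exact h F (fun x hx => by_contra fun hxT => hne ⟨x, hxT, hx⟩) hF)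
  have h1 := zir_le (maximal_isZIrSet_of_minimal hS)
  have h2 := Set.ncard_le_ncard hSs
  have h3 : ({a, b, c} : Set V).ncard = 3 := Set.ncard_eq_three.2 ⟨a, b, c, hab, hac, hbc, rfl⟩
  have h4 := Set.ncard_add_ncard_compl ({a, b, c} : Set V)
  rw [Nat.card_eq_fintype_card] at h4
  omega

/-! ### Nonedges between non-isolated vertices -/

/-- On the non-isolated vertices of `G`, the complement of `G` is a disjoint union of complete
bipartite graphs: the ends of every walk with three edges are adjacent. Closed walks are included,
so this also excludes triangles. -/
def CompletesWalks (G : SimpleGraph V) : Prop :=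
  ∀ a ∈ G.support, ∀ b ∈ G.support, ∀ c ∈ G.support, ∀ d ∈ G.support,
    Gᶜ.Adj a b → Gᶜ.Adj b c → Gᶜ.Adj c d → Gᶜ.Adj a d

/-- Every three vertices contain a fort. -/
def TriplesContainForts (G : SimpleGraph V) : Prop :=
  ∀ a b c : V, a ≠ b → a ≠ c → b ≠ c → ∃ F ⊆ {a, b, c}, IsFort G F

theorem IsFort.not_subset_singleton {F : Set V} (hF : IsFort G F) {a : V} (ha : a ∈ G.support) :
    ¬ F ⊆ {a} := by
  intro hFa
  obtain ⟨w, hw⟩ := ha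
  obtain ⟨x, hx⟩ := hF.1
  obtain rfl : x = a := hFa hx
  obtain ⟨y, hy, hyx, -⟩ := hF.exists_adj_ne (fun h => hw.ne (hFa h).symm) hx hw.symm
  exact hyx (hFa hy)

theorem IsFort.mem_left {F : Set V} (hF : IsFort G F) {a b : V} (hb : b ∈ G.support)
    (hFab : F ⊆ {a, b}) : a ∈ F := by
  by_contra ha
  exact hF.not_subset_singleton hb fun x hx =>
    (hFab hx).resolve_left fun h => ha (h ▸ hx)

theorem IsFort.adj_of_adj {F : Set V} (hF : IsFort G F) {a b : V} (hb : b ∈ G.support)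
    (hFab : F ⊆ {a, b}) {v : V} (hva : v ≠ a) (hvb : v ≠ b) (h : G.Adj v a) : G.Adj v b := by
  obtain ⟨y, hy, hya, hvy⟩ := hF.exists_adj_ne
    (fun hv => (hFab hv).elim hva hvb) (hF.mem_left hb hFab) h
  obtain rfl : y = b := (hFab hy).resolve_left hya
  exact hvy

/-- Two non-isolated vertices that contain a fort are twins. -/
theorem IsFort.adj_iff_adj {F : Set V} (hF : IsFort G F) {a b : V} (ha : a ∈ G.support)
    (hb : b ∈ G.support) (hFab : F ⊆ {a, b}) {v : V} (hva : v ≠ a) (hvb : v ≠ b) :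
    G.Adj v a ↔ G.Adj v b :=
  ⟨hF.adj_of_adj hb hFab hva hvb,
    hF.adj_of_adj ha (hFab.trans (Set.pair_comm a b).subset) hvb hva⟩

/-- If `u` tells the non-isolated vertices `a` and `b` apart, the fort among `a`, `b`, `c` contains
`c`, so no vertex outside has `c` as its only neighbour in the triple. -/
theorem TriplesContainForts.false_of_separated (h : TriplesContainForts G) {a b c u z : V}
    (ha : a ∈ G.support) (hb : b ∈ G.support) (hab : a ≠ b) (hac : a ≠ c) (hbc : b ≠ c)
    (hu : u ≠ a ∧ u ≠ b ∧ ¬ (G.Adj u a ↔ G.Adj u b)) (hz : z ≠ a ∧ z ≠ b)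
    (hza : ¬ G.Adj z a) (hzb : ¬ G.Adj z b) (hzc : G.Adj z c) : False := by
  obtain ⟨F, hFs, hF⟩ := h a b c hab hac hbc
  have hs : ∀ x ∈ F, x = a ∨ x = b ∨ x = c := fun x hx => by simpa using hFs hx
  have hC : c ∈ F := by
    by_contra hC
    exact hu.2.2 (hF.adj_iff_adj ha hb
      (fun x hx => (hs x hx).imp_right fun h => h.resolve_right fun h => hC (h ▸ hx)) hu.1 hu.2.1)
  obtain ⟨y, hy, hyc, hzy⟩ := hF.exists_adj_ne
    (fun hzF => by
      rcases hs z hzF with h | h | h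
      · exact hz.1 h
      · exact hz.2 h
      · exact hzc.ne h) hC hzc
  rcases hs y hy with rfl | rfl | rfl
  · exact hza hzy
  · exact hzb hzy
  · exact hyc rfl

/-- The graph has no induced path on four vertices. -/
theorem TriplesContainForts.not_path (h : TriplesContainForts G) {a b c d : V}
    (hab : G.Adj a b) (hbc : G.Adj b c) (hcd : G.Adj c d)
    (hac : ¬ G.Adj a c) (hbd : ¬ G.Adj b d) (had : ¬ G.Adj a d)
    (hne : a ≠ c) (hne' : b ≠ d) (hne'' : a ≠ d) : False :=
  h.false_of_separated (a := a) (b := b) (c := c) (u := c) (z := d)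
    ⟨b, hab⟩ ⟨a, hab.symm⟩ hab.ne hne hbc.ne
    ⟨hne.symm, hbc.ne', fun h => hac (h.2 hbc.symm).symm⟩ ⟨hne''.symm, hne'.symm⟩
    (fun h => had h.symm) (fun h => hbd h.symm) hcd.symm

/-- The graph has no induced path `a`, `v`, `b` with a further non-isolated vertex `c` adjacent to
none of the three. -/
theorem TriplesContainForts.adj_of_adj_of_adj (h : TriplesContainForts G) {a b c v : V}
    (hc : c ∈ G.support) (hne : a ≠ b) (hab : ¬ G.Adj a b) (hac : ¬ G.Adj a c)
    (hbc : ¬ G.Adj b c) (hva : G.Adj v a) (hvb : G.Adj v b) : G.Adj v c := by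
  by_contra hvc
  have h1 : v ≠ c := by rintro rfl; exact hac hva.symm
  have h2 : a ≠ c := by rintro rfl; exact hvc hva
  have h3 : b ≠ c := by rintro rfl; exact hvc hvb
  exact h.false_of_separated (a := c) (b := a) (c := v) (u := v) (z := b)
    hc ⟨v, hva.symm⟩ h2.symm h1.symm hva.ne' ⟨h1, hva.ne, fun h => hvc (h.2 hva)⟩ ⟨h3, hne.symm⟩
    hbc (fun h => hab h.symm) hvb.symm

/-- Twins `a`, `b` in an independent triple of non-isolated vertices `a`, `b`, `c`: each neighbour
of `c` is a neighbour of `a`. -/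
theorem TriplesContainForts.adj_of_twins (h : TriplesContainForts G) {a b c : V}
    (ha : a ∈ G.support) (hc : c ∈ G.support) (hne : a ≠ b) (hnac : a ≠ c) (hnbc : b ≠ c)
    (hab : ¬ G.Adj a b) (hac : ¬ G.Adj a c) (hbc : ¬ G.Adj b c)
    (ht : ∀ v, G.Adj v a ↔ G.Adj v b) {v : V} (hvc : G.Adj v c) : G.Adj v a := by
  by_contra hva
  obtain ⟨w, haw⟩ := ha
  have hwb := (ht w).1 haw.symm
  have hwc := h.adj_of_adj_of_adj hc hne hab hac hbc haw.symm hwb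
  have hvna : v ≠ a := by rintro rfl; exact hac hvc
  -- The vertex `v` tells `a` and `c` apart, and `b` sees only `w` among `a`, `c`, `w`.
  exact h.false_of_separated (a := a) (b := c) (c := w) (u := v) (z := b)
    ⟨w, haw⟩ hc hnac haw.ne hwc.ne' ⟨hvna, hvc.ne, fun h => hva (h.2 hvc)⟩ ⟨hne.symm, hnbc⟩
    (fun h => hab h.symm) hbc hwb.symm

theorem TriplesContainForts.adj_iff_of_twins (h : TriplesContainForts G) {a b c : V}
    (ha : a ∈ G.support) (hc : c ∈ G.support) (hne : a ≠ b) (hnac : a ≠ c) (hnbc : b ≠ c)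
    (hab : ¬ G.Adj a b) (hac : ¬ G.Adj a c) (hbc : ¬ G.Adj b c)
    (ht : ∀ v, G.Adj v a ↔ G.Adj v b) (v : V) : G.Adj v a ↔ G.Adj v c :=
  ⟨fun hva => h.adj_of_adj_of_adj hc hne hab hac hbc hva ((ht v).1 hva),
    h.adj_of_twins ha hc hne hnac hnbc hab hac hbc ht⟩

/-- Independent triples of non-isolated vertices consist of twins. -/
theorem TriplesContainForts.adj_iff_of_independent (h : TriplesContainForts G) {a b c : V}
    (ha : a ∈ G.support) (hb : b ∈ G.support) (hc : c ∈ G.support)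
    (hnab : a ≠ b) (hnac : a ≠ c) (hnbc : b ≠ c)
    (hab : ¬ G.Adj a b) (hac : ¬ G.Adj a c) (hbc : ¬ G.Adj b c) (v : V) :
    G.Adj v a ↔ G.Adj v b := by
  have hba : ¬ G.Adj b a := fun h => hab h.symm
  have hca : ¬ G.Adj c a := fun h => hac h.symm
  have hcb : ¬ G.Adj c b := fun h => hbc h.symm
  obtain ⟨F, hFs, hF⟩ := h a b c hnab hnac hnbc
  have hs : ∀ x ∈ F, x = a ∨ x = b ∨ x = c := fun x hx => by simpa using hFs hx
  have twins : ∀ {x y : V}, x ∈ G.support → y ∈ G.support → ¬ G.Adj x y → F ⊆ {x, y} →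
      ∀ v, G.Adj v x ↔ G.Adj v y := by
    intro x y hx hy hxy hFxy v
    rcases eq_or_ne v x with rfl | hvx
    · exact iff_of_false (G.irrefl) hxy
    rcases eq_or_ne v y with rfl | hvy
    · exact iff_of_false (fun h => hxy h.symm) (G.irrefl)
    exact hF.adj_iff_adj hx hy hFxy hvx hvy
  by_cases hC : c ∈ F
  · by_cases hA : a ∈ F
    · by_cases hB : b ∈ F
      · -- Here `F` is the whole triple: a neighbour of one of the three is adjacent to a second
        -- one, and then to all three.
        have hsub : ∀ v x, x ∈ F → G.Adj v x → v ∉ F := by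
          intro v x hx hvx hv
          rcases hs v hv with rfl | rfl | rfl <;> rcases hs x hx with rfl | rfl | rfl <;>
            first | exact G.irrefl hvx | contradiction
        constructor
        · intro hva
          obtain ⟨y, hy, hya, hvy⟩ := hF.exists_adj_ne (hsub v a hA hva) hA hva
          rcases hs y hy with rfl | rfl | rfl
          · exact (hya rfl).elim
          · exact hvy
          · exact h.adj_of_adj_of_adj hb hnac hac hab hcb hva hvy
        · intro hvb
          obtain ⟨y, hy, hyb, hvy⟩ := hF.exists_adj_ne (hsub v b hB hvb) hB hvb
          rcases hs y hy with rfl | rfl | rfl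
          · exact hvy
          · exact (hyb rfl).elim
          · exact h.adj_of_adj_of_adj ha hnbc hbc hba hca hvb hvy
      · have ht := twins ha hc hac fun x hx => by
          rcases hs x hx with rfl | rfl | rfl
          · simp
          · exact (hB hx).elim
          · simp
        exact h.adj_iff_of_twins ha hb hnac hnab hnbc.symm hac hab hcb ht v
    · have ht := twins hb hc hbc fun x hx => by
        rcases hs x hx with rfl | rfl | rfl
        · exact (hA hx).elim
        · simp
        · simp
      exact (h.adj_iff_of_twins hb ha hnbc hnab.symm hnac.symm hbc hba hca ht v).symm
  · exact twins ha hb hab (fun x hx => by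
      rcases hs x hx with rfl | rfl | rfl
      · simp
      · simp
      · exact (hC hx).elim) v

/-- The non-isolated vertices contain no independent triple: the open twin class of such a triple
would have a maximal Z-irredundant set as its complement. -/
theorem TriplesContainForts.not_independent [Fintype V] (h : TriplesContainForts G)
    (hz : Fintype.card V - 2 ≤ zir G) (hn : 3 ≤ Fintype.card V) {a b c : V}
    (ha : a ∈ G.support) (hb : b ∈ G.support) (hc : c ∈ G.support)
    (hnab : a ≠ b) (hnac : a ≠ c) (hnbc : b ≠ c)
    (hab : ¬ G.Adj a b) (hac : ¬ G.Adj a c) (hbc : ¬ G.Adj b c) : False := by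
  set D : Set V := {x | ∀ v, G.Adj v a ↔ G.Adj v x} with hD
  have haD : a ∈ D := fun v => Iff.rfl
  have hbD : b ∈ D := h.adj_iff_of_independent ha hb hc hnab hnac hnbc hab hac hbc
  have hcD : c ∈ D :=
    h.adj_iff_of_independent ha hc hb hnac hnab hnbc.symm hac hab (fun h => hbc h.symm)
  obtain ⟨w, haw⟩ := ha
  have hDadj : ∀ x ∈ D, ∀ v, G.Adj v a ↔ G.Adj v x := fun x hx => hx
  have hDD : ∀ x ∈ D, ∀ y ∈ D, ¬ G.Adj x y := fun x hx y hy hxy =>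
    G.irrefl ((hDadj x hx a).2 ((hDadj y hy x).2 hxy).symm)
  have hwD : w ∉ D := fun hw => hDD a haD w hw haw
  have hmax : Maximal (IsZIrSet G) Dᶜ := by
    refine ⟨isZIrSet_iff.2 fun x hx => ?_, fun T hT hDT y hyT hyD => ?_⟩
    · by_cases hxU : x ∈ G.support
      · refine ⟨insert x D, isFort_iff.2 ⟨⟨x, .inl rfl⟩, fun v hv y hy hvy => ?_⟩, .inl rfl,
          fun y hy hyD => hy.resolve_right hyD⟩
        by_cases hva : G.Adj v a
        · by_cases hya : y = a
          · exact ⟨b, .inr hbD, fun h => hnab (hya.symm.trans h.symm), (hDadj b hbD v).1 hva⟩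
          · exact ⟨a, .inr haD, fun h => hya h.symm, hva⟩
        · -- Such a `v` would form an independent triple with `a` and `b`, and so lie in `D`.
          exfalso
          have hvb : ¬ G.Adj v b := fun hvb => hva ((hDadj b hbD v).2 hvb)
          have hvD : v ∉ D := fun hvD => hv (.inr hvD)
          exact hvD (h.adj_iff_of_independent ⟨w, haw⟩ ⟨y, hvy⟩ hb
            (fun h => hvD (h ▸ haD)) hnab (fun h => hvD (h ▸ hbD)) (fun h => hva h.symm) hab hvb)
      · exact ⟨{x}, isFort_singleton hxU, rfl, fun y hy _ => hy⟩
    · obtain ⟨F, hF, hwF, hFT⟩ := isZIrSet_iff.1 hT w (hDT hwD)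
      have hyF : y ∉ F := fun h => hwD (hFT y h hyT ▸ hyD)
      obtain ⟨x, hx, hxw, hyx⟩ := hF.exists_adj_ne hyF hwF ((hDadj y hyD w).1 haw.symm).symm
      exact hDD y hyD x (by_contra fun hxD => hxw (hFT x hx (hDT hxD))) hyx
  have h1 := zir_le hmax
  have h3 : ({a, b, c} : Set V).ncard = 3 :=
    Set.ncard_eq_three.2 ⟨a, b, c, hnab, hnac, hnbc, rfl⟩
  have h2 : ({a, b, c} : Set V).ncard ≤ D.ncard :=
    Set.ncard_le_ncard (by rintro x (rfl | rfl | rfl) <;> assumption)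
  have h4 := Set.ncard_add_ncard_compl D
  rw [Nat.card_eq_fintype_card] at h4
  omega

theorem completesWalks_of_le_zir [Fintype V] (hz : Fintype.card V - 2 ≤ zir G)
    (hn : 3 ≤ Fintype.card V) : CompletesWalks G := by
  have h : TriplesContainForts G := fun a b c hab hac hbc =>
    exists_isFort_subset_triple hz hab hac hbc
  have key : ∀ {x y z : V}, x ∈ G.support → y ∈ G.support → z ∈ G.support →
      Gᶜ.Adj x y → Gᶜ.Adj y z → x ≠ z → G.Adj x z := fun hx hy hz' hxy hyz hxz =>
    by_contra fun hadj => h.not_independent hz hn hx hy hz' hxy.ne hxz hyz.ne hxy.2 hadj hyz.2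
  intro a ha b hb c hc d hd hab hbc hcd
  by_cases hac : a = c
  · exact hac ▸ hcd
  by_cases hbd : b = d
  · exact hbd ▸ hab
  have hac' := key ha hb hc hab hbc hac
  have hbd' := key hb hc hd hbc hcd hbd
  have had : a ≠ d := by
    rintro rfl
    exact hcd.2 hac'.symm
  by_contra hnad
  have hadj : G.Adj a d := by_contra fun h => hnad ⟨had, h⟩
  exact h.not_path hac'.symm hadj hbd'.symm hcd.2 hab.2 (fun h => hbc.2 h.symm) hcd.ne hab.ne
    hbc.ne'

/-! ### Z-irredundant sets missing one or two vertices -/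

/-- A Z-irredundant set missing a single non-isolated vertex makes all non-isolated vertices twins
of it, so that they form a clique. -/
theorem not_isZIrSet_compl_singleton {a b : V} (ha : a ∈ G.support) (hb : b ∈ G.support)
    (hab : Gᶜ.Adj a b) (v : V) : ¬ IsZIrSet G {v}ᶜ := by
  intro hvS
  obtain ⟨v, hv, hS⟩ : ∃ v ∈ G.support, IsZIrSet G {v}ᶜ := by
    by_cases hv : v ∈ G.support
    · exact ⟨v, hv, hvS⟩
    · refine ⟨a, ha, hvS.union_compl_support.mono fun x _ => ?_⟩
      by_cases hxv : x = v
      · exact .inr (hxv ▸ hv)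
      · exact .inl hxv
  have twin : ∀ x ∈ G.support, x ≠ v → ∀ u, u ≠ x → u ≠ v → (G.Adj u x ↔ G.Adj u v) := by
    intro x hx hxv u hux huv
    obtain ⟨F, hF, -, hFS⟩ := isZIrSet_iff.1 hS x hxv
    exact hF.adj_iff_adj hx hv
      (fun y hy => or_iff_not_imp_right.2 fun hyv => hFS y hy hyv) hux huv
  obtain ⟨w, haw⟩ := ha
  replace haw : G.Adj a w := haw
  have hbw : w ≠ b := by rintro rfl; exact hab.2 haw
  have taw := fun h => twin a ⟨w, haw⟩ h w haw.ne'
  have tab := fun h => twin a ⟨w, haw⟩ h b hab.ne'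
  have tba := fun h => twin b hb h a hab.ne
  have tbw := fun h => twin b hb h w hbw
  have twa := fun h => twin w ⟨a, haw.symm⟩ h a haw.ne
  have twb := fun h => twin w ⟨a, haw.symm⟩ h b hbw.symm
  have h1 := hab.ne
  have h2 := hab.2
  have h3 := haw.ne
  have h4 := haw.symm
  have h5 : ¬ G.Adj b a := fun h => h2 h.symm
  have h6 := G.adj_comm b w
  clear twin hS hvS
  by_cases hva : a = v
  · subst hva; grind
  by_cases hvb : b = v
  · subst hvb; grind
  by_cases hvw : w = v
  · subst hvw; grind
  grind

/-- Two vertices without a common non-neighbour can be the two missing vertices: if `{x, a, b}`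
is not a fort, then `x` has a common non-neighbour with `a` or with `b`, and so is its twin. -/
theorem CompletesWalks.isZIrSet_compl_pair (h : CompletesWalks G) {a b : V}
    (ha : a ∈ G.support) (hb : b ∈ G.support) (hne : a ≠ b)
    (hab : ∀ c ∈ G.support, Gᶜ.Adj a c → Gᶜ.Adj c b → False) : IsZIrSet G {a, b}ᶜ := by
  have twins : ∀ {x y v : V}, x ∈ G.support → y ∈ G.support → v ∈ G.support → x ≠ y →
      Gᶜ.Adj x v → Gᶜ.Adj v y → IsFort G {x, y} := by
    have aux : ∀ {x y v w : V}, x ∈ G.support → y ∈ G.support → v ∈ G.support → Gᶜ.Adj x v →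
        Gᶜ.Adj v y → w ≠ y → G.Adj w x → G.Adj w y := by
      intro x y v w hx hy hv hxv hvy hwy hwx
      by_contra hn
      have hwx' : Gᶜ.Adj w x :=
        h w ⟨x, hwx⟩ y hy v hv x hx ⟨hwy, hn⟩ hvy.symm hxv.symm
      exact hwx'.2 hwx
    intro x y v hx hy hv hxy hxv hvy
    refine isFort_iff.2 ⟨⟨x, .inl rfl⟩, ?_⟩
    rintro w hw z (rfl | rfl) hwz
    · exact ⟨y, .inr rfl, hxy.symm, aux hx hy hv hxv hvy (fun h => hw (.inr h)) hwz⟩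
    · exact ⟨x, .inl rfl, hxy, aux hy hx hv hvy.symm hxv.symm (fun h => hw (.inl h)) hwz⟩
  rw [isZIrSet_iff]
  intro x hx
  have hxa : x ≠ a := fun h => hx (.inl h)
  have hxb : x ≠ b := fun h => hx (.inr h)
  by_cases hxU : x ∈ G.support
  swap
  · exact ⟨{x}, isFort_singleton hxU, rfl, fun y hy _ => hy⟩
  by_cases hF : IsFort G {x, a, b}
  · exact ⟨_, hF, .inl rfl, fun y hy hyS => hy.resolve_right hyS⟩
  rw [isFort_iff] at hF
  push Not at hF
  obtain ⟨v, hv, z, hz, hvz, hvF⟩ := hF ⟨x, .inl rfl⟩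
  have hvU : v ∈ G.support := ⟨z, hvz⟩
  have hcompl : ∀ y ∈ ({x, a, b} : Set V), y ≠ z → Gᶜ.Adj v y := fun y hy hyz =>
    ⟨fun h => hv (h ▸ hy), hvF y hy hyz⟩
  rcases hz with rfl | rfl | rfl
  · exact (hab v hvU (hcompl a (by simp) hxa.symm).symm (hcompl b (by simp) hxb.symm)).elim
  · refine ⟨{x, b}, twins hxU hb hvU hxb (hcompl x (by simp) hxa).symm
      (hcompl b (by simp) hne.symm), .inl rfl, fun y hy hyS => hy.resolve_right fun h => ?_⟩
    exact hyS (.inr h)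
  · refine ⟨{x, a}, twins hxU ha hvU hxa (hcompl x (by simp) hxb).symm
      (hcompl a (by simp) hne), .inl rfl, fun y hy hyS => hy.resolve_right fun h => ?_⟩
    exact hyS (.inl h)

/-- A maximal Z-irredundant set does not miss three vertices. Otherwise any two missing vertices
have a common non-neighbour, hence all have the same one, `c`; a neighbour `d` of `c` then has no
private fort, because `c` sees `d` but no missing vertex. -/
theorem CompletesWalks.not_three_missing (h : CompletesWalks G) {S : Set V}
    (hS : Maximal (IsZIrSet G) S) {x y z : V} (hx : x ∉ S) (hy : y ∉ S) (hz : z ∉ S)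
    (hxy : x ≠ y) (hxz : x ≠ z) (hyz : y ≠ z) : False := by
  have hU : ∀ t ∉ S, t ∈ G.support := fun t ht => mem_support_of_notMem_maximal hS ht
  have hcommon : ∀ s ∉ S, ∀ t ∉ S, s ≠ t →
      ∃ c ∈ G.support, Gᶜ.Adj s c ∧ Gᶜ.Adj c t := by
    intro s hs t ht hst
    by_contra! hno
    have hpair := h.isZIrSet_compl_pair (hU s hs) (hU t ht) hst
      fun c hc h1 h2 => hno c hc h1 h2
    have hsub : S ⊆ {s, t}ᶜ := by
      rintro u hu (rfl | rfl)
      · exact hs hu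
      · exact ht hu
    have heq : ∀ u ∉ S, u = s ∨ u = t := fun u hu =>
      by_contra fun hn => hu (hS.2 hpair hsub hn)
    have := heq x hx
    have := heq y hy
    have := heq z hz
    grind
  obtain ⟨c, hc, hxc, hcy⟩ := hcommon x hx y hy hxy
  have hcall : ∀ t ∉ S, Gᶜ.Adj c t := by
    intro t ht
    by_cases htx : t = x
    · exact htx ▸ hxc.symm
    obtain ⟨e, he, hxe, het⟩ := hcommon x hx t ht (fun h => htx h.symm)
    exact h c hc x (hU x hx) e he t (hU t ht) hxc.symm hxe het
  have hcS : c ∈ S := by_contra fun hcS => (hcall c hcS).ne rfl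
  obtain ⟨d, hcd⟩ := hc
  have hdS : d ∈ S := by_contra fun hdS => (hcall d hdS).2 hcd
  obtain ⟨F, hF, hdF, hFS⟩ := isZIrSet_iff.1 hS.1 d hdS
  have hcF : c ∉ F := fun h => hcd.ne (hFS c h hcS)
  obtain ⟨t, ht, htd, hct⟩ := hF.exists_adj_ne hcF hdF hcd
  exact (hcall t fun htS => htd (hFS t ht htS)).2 hct

/-- Complete graphs plus isolated vertices are excluded: a Z-irredundant set missing two
non-isolated vertices then extends to one missing a single vertex. -/
theorem exists_compl_adj_of_zir_eq [Fintype V] (hn : 3 ≤ Fintype.card V)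
    (hz : zir G = Fintype.card V - 2) :
    ∃ a ∈ G.support, ∃ b ∈ G.support, Gᶜ.Adj a b := by
  by_contra! hno
  obtain ⟨S, hS, hSc⟩ := exists_ncard_eq_zir G
  have h4 := Set.ncard_add_ncard_compl S
  rw [Nat.card_eq_fintype_card] at h4
  have h2 : Sᶜ.ncard = 2 := by omega
  obtain ⟨a, b, hab, hSab⟩ := Set.ncard_eq_two.1 h2
  have haS : a ∉ S := hSab.symm.subset (.inl rfl)
  have hbS : b ∉ S := hSab.symm.subset (.inr rfl)
  have hU : ∀ t ∉ S, t ∈ G.support := fun t ht => mem_support_of_notMem_maximal hS ht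
  have hadj : ∀ x ∈ G.support, ∀ y ∈ G.support, x ≠ y → G.Adj x y := fun x hx y hy hxy =>
    by_contra fun h => hno x hx y hy ⟨hxy, h⟩
  have hZ : IsZIrSet G {b}ᶜ := by
    refine isZIrSet_iff.2 fun x hx => ?_
    by_cases hxU : x ∈ G.support
    · refine ⟨{x, b}, isFort_iff.2 ⟨⟨x, .inl rfl⟩, ?_⟩, .inl rfl,
        fun y hy hyb => hy.resolve_right hyb⟩
      rintro v hv y (rfl | rfl) hvy
      · exact ⟨b, .inr rfl, fun h => hx h.symm, hadj v ⟨_, hvy⟩ b (hU b hbS) fun h =>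
          hv (.inr h)⟩
      · exact ⟨x, .inl rfl, hx, hadj v ⟨_, hvy⟩ x hxU fun h => hv (.inl h)⟩
    · exact ⟨{x}, isFort_singleton hxU, rfl, fun y hy _ => hy⟩
  exact haS (hS.2 hZ (fun u hu h => hbS (h ▸ hu)) hab)

/-- The structural form of `zir G = n - 2`: the first condition says that no maximal Z-irredundant
set misses three vertices, the second that none misses fewer than two. -/
theorem zir_eq_iff [Fintype V] (hn : 3 ≤ Fintype.card V) :
    zir G = Fintype.card V - 2 ↔
      CompletesWalks G ∧ ∃ a ∈ G.support, ∃ b ∈ G.support, Gᶜ.Adj a b := by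
  refine ⟨fun hz => ⟨completesWalks_of_le_zir hz.ge hn, exists_compl_adj_of_zir_eq hn hz⟩, ?_⟩
  rintro ⟨h, a, ha, b, hb, hab⟩
  obtain ⟨S, hS, hSc⟩ := exists_ncard_eq_zir G
  have h4 := Set.ncard_add_ncard_compl S
  rw [Nat.card_eq_fintype_card] at h4
  have h5 : Sᶜ.ncard ≤ 2 := by
    by_contra! h5
    obtain ⟨x, y, z, hx, hy, hz, hxy, hxz, hyz⟩ := (Set.two_lt_ncard_iff).1 h5
    exact h.not_three_missing hS hx hy hz hxy hxz hyz
  have h6 : 2 ≤ Sᶜ.ncard := by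
    by_contra! h6
    obtain ⟨v, hv⟩ : ∃ v, {v}ᶜ ⊆ S := by
      have h7 : Sᶜ.ncard ≤ 1 := by omega
      rcases Set.eq_empty_or_nonempty Sᶜ with he | ⟨v, hv⟩
      · exact ⟨a, fun u _ => by_contra fun hu => (he.subset hu : u ∈ (∅ : Set V))⟩
      · exact ⟨v, fun u huv => by_contra fun hu =>
          huv ((Set.ncard_le_one_iff (Set.toFinite _)).1 h7 hu hv)⟩
    exact not_isZIrSet_compl_singleton ha hb hab v (hS.1.mono hv)
  omega

/-! ### Disjoint unions of complete bipartite graphs -/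

section Bicliques

universe u

variable {W : Type u} {K : SimpleGraph W}

/-- A graph in which the ends of every three-edge walk are adjacent is a disjoint union of complete
bipartite graphs. Its parts are the classes of vertices with equal neighbourhoods, and two vertices
lie in the same piece if they are adjacent or in the same part; in particular the isolated vertices
together form one piece. -/
theorem exists_bipartition
    (hK : ∀ a b c d, K.Adj a b → K.Adj b c → K.Adj c d → K.Adj a d) :
    ∃ (Q : Type u) (comp : W → Q) (side : W → Bool), Function.Surjective comp ∧
      (∀ x y, K.Adj x y ↔ comp x = comp y ∧ side x ≠ side y) ∧
      ∀ x y, (∀ z, ¬ K.Adj x z) → (∀ z, ¬ K.Adj y z) → comp x = comp y := by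
  classical
  let s : Setoid W :=
    { r := fun x y => K.Adj x y ∨ ∀ z, K.Adj x z ↔ K.Adj y z
      iseqv :=
        { refl := fun x => .inr fun _ => Iff.rfl
          symm := by
            rintro x y (h | h)
            · exact .inl h.symm
            · exact .inr fun z => (h z).symm
          trans := by
            rintro x y z (hxy | hxy) (hyz | hyz)
            · exact .inr fun w => ⟨fun h => hK z y x w hyz.symm hxy.symm h,
                fun h => hK x y z w hxy hyz h⟩
            · exact .inl ((hyz x).1 hxy.symm).symm
            · exact .inl ((hxy z).2 hyz)
            · exact .inr fun w => (hxy w).trans (hyz w) } }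
  let root : Quotient s → W := Quotient.out
  have hroot : ∀ x, K.Adj x (root ⟦x⟧) ∨ ∀ z, K.Adj x z ↔ K.Adj (root ⟦x⟧) z := fun x =>
    s.symm (Quotient.exact (Quotient.out_eq (⟦x⟧ : Quotient s)))
  refine ⟨Quotient s, Quotient.mk s, fun x => decide (K.Adj x (root ⟦x⟧)),
    Quotient.mk_surjective, fun x y => ?_,
    fun x y hx hy => Quotient.sound (.inr fun z => iff_of_false (hx z) (hy z))⟩
  constructor
  · intro hxy
    have hq : (⟦x⟧ : Quotient s) = ⟦y⟧ := Quotient.sound (.inl hxy)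
    refine ⟨hq, fun hside => ?_⟩
    have hx := hroot x
    have hy := hroot y
    beta_reduce at hside
    rw [hq] at hx hside
    rw [decide_eq_decide] at hside
    set ρ := root ⟦y⟧
    by_cases h : K.Adj x ρ
    · exact K.irrefl (hK x y ρ x hxy (hside.1 h) h.symm)
    · exact h (((hy.resolve_left fun h' => h (hside.2 h')) x).1 hxy.symm).symm
  · rintro ⟨hq, hside⟩
    have hx := hroot x
    have hy := hroot y
    change (⟦x⟧ : Quotient s) = ⟦y⟧ at hq
    beta_reduce at hside
    rw [hq] at hx hside
    rw [Ne, decide_eq_decide] at hside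
    set ρ := root ⟦y⟧
    by_cases h : K.Adj x ρ
    · have h' : ¬ K.Adj y ρ := fun h' => hside (iff_of_true h h')
      exact (((hy.resolve_left h') x).2 h.symm).symm
    · have h' : K.Adj y ρ := by_contra fun h' => hside (iff_of_false h h')
      exact ((hx.resolve_left h) y).2 h'.symm

/-- The sides and the pieces can be arranged so that the first side of each piece is the smaller
one, and the sizes of the first sides decrease. -/
theorem exists_sorted_bipartition [Finite W]
    (hK : ∀ a b c d, K.Adj a b → K.Adj b c → K.Adj c d → K.Adj a d) :
    ∃ (k : ℕ) (comp : W → Fin k) (side : W → Bool), Function.Surjective comp ∧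
      (∀ x y, K.Adj x y ↔ comp x = comp y ∧ side x ≠ side y) ∧
      (∀ x y, (∀ z, ¬ K.Adj x z) → (∀ z, ¬ K.Adj y z) → comp x = comp y) ∧
      (∀ i, {x | comp x = i ∧ side x = false}.ncard ≤ {x | comp x = i ∧ side x = true}.ncard) ∧
      Antitone fun i => {x | comp x = i ∧ side x = false}.ncard := by
  classical
  obtain ⟨Q, comp, side, hsurj, hadj, hiso⟩ := exists_bipartition hK
  have : Finite Q := Finite.of_surjective comp hsurj
  let flip : Q → Bool := fun c => decide
    ({x | comp x = c ∧ side x = true}.ncard < {x | comp x = c ∧ side x = false}.ncard)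
  let side' : W → Bool := fun x => xor (side x) (flip (comp x))
  have hside' : ∀ c b, {x | comp x = c ∧ side' x = b} =
      {x | comp x = c ∧ side x = xor b (flip c)} := by
    intro c b
    ext x
    refine and_congr_right fun (hx : comp x = c) => ?_
    subst hx
    change xor (side x) (flip (comp x)) = b ↔ _
    generalize side x = u
    generalize flip (comp x) = v
    revert u v b
    decide
  have hle : ∀ c, {x | comp x = c ∧ side' x = false}.ncard ≤
      {x | comp x = c ∧ side' x = true}.ncard := by
    intro c
    rw [hside', hside']
    by_cases h : {x | comp x = c ∧ side x = true}.ncard < {x | comp x = c ∧ side x = false}.ncard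
    · have : flip c = true := decide_eq_true h
      rw [this]
      exact h.le
    · have : flip c = false := decide_eq_false h
      rw [this]
      exact not_lt.1 h
  let e := Finite.equivFin Q
  let f : Fin (Nat.card Q) → ℕᵒᵈ := fun i =>
    OrderDual.toDual {x | comp x = e.symm i ∧ side' x = false}.ncard
  let σ := Tuple.sort f
  have hset : ∀ i b, {x | σ.symm (e (comp x)) = i ∧ side' x = b} =
      {x | comp x = e.symm (σ i) ∧ side' x = b} := by
    intro i b
    ext x
    refine and_congr_left fun _ => ?_
    rw [Equiv.symm_apply_eq, ← Equiv.eq_symm_apply]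
  refine ⟨Nat.card Q, fun x => σ.symm (e (comp x)), side',
    σ.symm.surjective.comp (e.surjective.comp hsurj), fun x y => ?_,
    fun x y hx hy => congrArg (fun c => σ.symm (e c)) (hiso x y hx hy), fun i => ?_, ?_⟩
  · rw [hadj, ← (σ.symm.injective.comp e.injective).eq_iff (a := comp x)]
    refine and_congr_right fun h => not_congr ?_
    replace h : comp x = comp y := (σ.symm.injective.comp e.injective) h
    change _ ↔ xor (side x) (flip (comp x)) = xor (side y) (flip (comp y))
    rw [h, Bool.xor_left_inj]
  · rw [hset, hset]
    exact hle _
  · intro i j hij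
    have := Tuple.monotone_sort f hij
    simp only [hset]
    exact this

end Bicliques

/-! ### Recognizing the model graph by labels -/

section Labels

variable {k : ℕ} {q p : Fin k → ℕ} {r : ℕ}

/-- The part of the model graph that contains a vertex: the side `false` (of size `q i`) or `true`
(of size `p i`) of the `i`-th complete bipartite graph, or `none` for the vertices of `K_r`. -/
def label : (Σ i : Fin k, Fin (q i) ⊕ Fin (p i)) ⊕ Fin r → Option (Fin k × Bool)
  | .inl ⟨i, .inl _⟩ => some (i, false)
  | .inl ⟨i, .inr _⟩ => some (i, true)
  | .inr _ => none

/-- Adjacency of distinct vertices of the model graph in terms of their labels. -/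
def LabelAdj (l m : Option (Fin k × Bool)) : Prop :=
  ∀ a ∈ l, ∀ b ∈ m, a.1 = b.1 ∧ a.2 ≠ b.2

theorem disjointUnion_completeBipartiteGraph_adj {i j : Fin k} {x : Fin (q i) ⊕ Fin (p i)}
    {y : Fin (q j) ⊕ Fin (p j)} :
    (disjointUnion fun i => completeBipartiteGraph (Fin (q i)) (Fin (p i))).Adj ⟨i, x⟩ ⟨j, y⟩ ↔
      i = j ∧ x.isLeft ≠ y.isLeft := by
  constructor
  · rintro ⟨l, x', y', h, hx, hy⟩
    obtain ⟨rfl, hx⟩ := Sigma.mk.inj hx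
    obtain ⟨rfl, hy⟩ := Sigma.mk.inj hy
    obtain rfl := eq_of_heq hx
    obtain rfl := eq_of_heq hy
    refine ⟨rfl, ?_⟩
    rcases x with x | x <;> rcases y with y | y <;> simp_all
  · rintro ⟨rfl, h⟩
    refine ⟨i, x, y, ?_, rfl, rfl⟩
    rcases x with x | x <;> rcases y with y | y <;> simp_all

theorem bipartiteUnionJoin_adj {x y : (Σ i : Fin k, Fin (q i) ⊕ Fin (p i)) ⊕ Fin r} :
    (bipartiteUnionJoin q p r).Adj x y ↔ x ≠ y ∧ LabelAdj (label x) (label y) := by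
  rcases x with ⟨i, x | x⟩ | x <;> rcases y with ⟨j, y | y⟩ | y
  all_goals simp [bipartiteUnionJoin, join, label, LabelAdj,
    disjointUnion_completeBipartiteGraph_adj]
  all_goals
    rintro rfl
    simp

theorem nonempty_iso_of_label {V : Type*} [Finite V] {H : SimpleGraph V}
    (l : V → Option (Fin k × Bool)) (hl : ∀ x y, H.Adj x y ↔ x ≠ y ∧ LabelAdj (l x) (l y))
    (hq : ∀ i, {x | l x = some (i, false)}.ncard = q i)
    (hp : ∀ i, {x | l x = some (i, true)}.ncard = p i)
    (hr : {x | l x = none}.ncard = r) : Nonempty (H ≃g bipartiteUnionJoin q p r) := by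
  have hfib : ∀ c, Nonempty ({x // l x = c} ≃
      {y : (Σ i : Fin k, Fin (q i) ⊕ Fin (p i)) ⊕ Fin r // label y = c}) := by
    rintro (_ | ⟨i, _ | _⟩)
    · refine ⟨(Finite.equivFinOfCardEq hr).trans
        (Equiv.ofBijective (fun j => ⟨.inr j, rfl⟩) ⟨?_, ?_⟩)⟩
      · intro a b h
        simpa using congrArg Subtype.val h
      · rintro ⟨⟨i, x | x⟩ | x, hx⟩
        · cases hx
        · cases hx
        · exact ⟨x, rfl⟩
    · refine ⟨(Finite.equivFinOfCardEq (hq i)).trans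
        (Equiv.ofBijective (fun j => ⟨.inl ⟨i, .inl j⟩, rfl⟩) ⟨?_, ?_⟩)⟩
      · intro a b h
        simpa using congrArg Subtype.val h
      · rintro ⟨⟨i, x | x⟩ | x, hx⟩
        · cases hx
          exact ⟨x, rfl⟩
        · cases hx
        · cases hx
    · refine ⟨(Finite.equivFinOfCardEq (hp i)).trans
        (Equiv.ofBijective (fun j => ⟨.inl ⟨i, .inr j⟩, rfl⟩) ⟨?_, ?_⟩)⟩
      · intro a b h
        simpa using congrArg Subtype.val h
      · rintro ⟨⟨i, x | x⟩ | x, hx⟩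
        · cases hx
        · cases hx
          exact ⟨x, rfl⟩
        · cases hx
  let e := fun c => (hfib c).some
  refine ⟨⟨Equiv.ofFiberEquiv e, fun {x y} => ?_⟩⟩
  have hlabel : ∀ x, label (Equiv.ofFiberEquiv e x) = l x := Equiv.ofFiberEquiv_map e
  rw [bipartiteUnionJoin_adj, hl, hlabel, hlabel, (Equiv.injective _).ne_iff]

end Labels

/-! ### Nonedges and the model graph -/

section Model

theorem CompletesWalks.exists_iso [Finite V] (h : CompletesWalks G)
    (hE : ∃ a ∈ G.support, ∃ b ∈ G.support, Gᶜ.Adj a b) :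
    ∃ (k : ℕ) (hk : 1 ≤ k) (q p : Fin k → ℕ) (r : ℕ),
      (∀ i, q i ≤ p i) ∧
      (∀ i j : Fin k, j.val = i.val + 1 → q j ≤ q i) ∧
      (∀ i, 1 ≤ p i) ∧
      (∀ i : Fin k, i.val + 2 = k → 1 ≤ q i) ∧
      (2 ≤ q ⟨0, hk⟩ ∨ (q ⟨0, hk⟩ = 1 ∧ 2 ≤ k)) ∧
      Nonempty (Gᶜ ≃g bipartiteUnionJoin q p r) := by
  classical
  obtain ⟨k, comp, side, hsurj, hadj, hiso, hle, hanti⟩ :=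
    exists_sorted_bipartition (K := Gᶜ.induce G.support)
      fun a b c d => h a a.2 b b.2 c c.2 d d.2
  let part : Fin k → Bool → Set G.support := fun i b => {x | comp x = i ∧ side x = b}
  change ∀ i, (part i false).ncard ≤ (part i true).ncard at hle
  change Antitone fun i => (part i false).ncard at hanti
  have hpos : ∀ x, 1 ≤ (part (comp x) (side x)).ncard := fun x =>
    (Set.ncard_pos (Set.toFinite _)).2 ⟨x, rfl, rfl⟩
  have hedge : ∀ x y, (Gᶜ.induce G.support).Adj x y → 1 ≤ (part (comp x) false).ncard := by
    intro x y hxy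
    obtain ⟨hc, hs⟩ := (hadj x y).1 hxy
    have hx := hpos x
    have hy := hpos y
    rw [← hc] at hy
    revert hs hx hy
    generalize side x = u
    generalize side y = v
    cases u <;> cases v <;> simp +contextual
  obtain ⟨a, ha, b, hb, hab⟩ := hE
  have hk : 1 ≤ k := Fin.pos (comp ⟨a, ha⟩)
  have hq0 : 1 ≤ (part ⟨0, hk⟩ false).ncard :=
    (hedge ⟨a, ha⟩ ⟨b, hb⟩ hab).trans (hanti (Fin.mk_le_of_le_val (Nat.zero_le _)))
  let l : V → Option (Fin k × Bool) := fun v =>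
    if hv : v ∈ G.support then some (comp ⟨v, hv⟩, side ⟨v, hv⟩) else none
  have hlpart : ∀ i b, {v | l v = some (i, b)}.ncard = (part i b).ncard := by
    intro i b
    rw [← Set.ncard_image_of_injective (part i b) Subtype.val_injective]
    congr 1
    ext v
    by_cases hv : v ∈ G.support <;> simp [l, part, hv]
  refine ⟨k, hk, fun i => (part i false).ncard, fun i => (part i true).ncard,
    {v | l v = none}.ncard, hle, fun i j hij => hanti (Fin.le_def.2 (by omega)), fun i => ?_,
    fun i hi => ?_, ?_, ?_⟩
  · obtain ⟨x, rfl⟩ := hsurj i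
    have hx := hpos x
    cases hs : side x
    · rw [hs] at hx
      exact hx.trans (hle _)
    · rwa [hs] at hx
  · -- Otherwise the last two pieces are edgeless, but the isolated vertices form a single piece.
    by_contra hqi
    have hj : i.val + 1 < k := by omega
    obtain ⟨x, hx⟩ := hsurj i
    obtain ⟨y, hy⟩ := hsurj ⟨i.val + 1, hj⟩
    have hqj := hanti (show i ≤ ⟨i.val + 1, hj⟩ from Fin.le_def.2 (Nat.le_succ _))
    have hxy := hiso x y (fun z hz => hqi (hx ▸ hedge x z hz))
      (fun z hz => hqi ((hy ▸ hedge y z hz).trans hqj))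
    rw [hx, hy] at hxy
    exact absurd (congrArg Fin.val hxy) (by simp)
  · -- The smaller side of a single piece contains a vertex and a neighbour of it in `G`.
    rcases hq0.lt_or_eq with hq | hq
    · exact .inl hq
    refine .inr ⟨hq.symm, ?_⟩
    by_contra hk2
    obtain rfl : k = 1 := by omega
    obtain ⟨x, -, hx⟩ := Set.nonempty_of_ncard_ne_zero (Nat.one_le_iff_ne_zero.1 hq0)
    obtain ⟨w, hxw⟩ := x.2
    replace hxw : G.Adj x w := hxw
    have hs : side x = side ⟨w, x, hxw.symm⟩ := by
      by_contra hs
      exact ((hadj x ⟨w, x, hxw.symm⟩).2 ⟨Subsingleton.elim _ _, hs⟩).2 hxw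
    have hxw' : x = ⟨w, x, hxw.symm⟩ := (Set.ncard_le_one_iff (Set.toFinite _)).1 hq.ge
      ⟨Subsingleton.elim _ _, hx⟩ ⟨Subsingleton.elim _ _, hs ▸ hx⟩
    exact hxw.ne (congrArg Subtype.val hxw')
  · refine nonempty_iso_of_label l (fun x y => ?_) (fun i => hlpart i false)
      (fun i => hlpart i true) rfl
    by_cases hx : x ∈ G.support
    · by_cases hy : y ∈ G.support
      · have hxy := hadj ⟨x, hx⟩ ⟨y, hy⟩
        have hne : Gᶜ.Adj x y → x ≠ y := SimpleGraph.Adj.ne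
        have hne' : comp ⟨x, hx⟩ = comp ⟨y, hy⟩ ∧ side ⟨x, hx⟩ ≠ side ⟨y, hy⟩ → x ≠ y := by
          rintro ⟨-, hs⟩ rfl
          exact hs rfl
        simp only [l, hx, hy, dif_pos, LabelAdj, Option.mem_def, Option.some.injEq,
          forall_eq']
        exact ⟨fun h => ⟨hne h, hxy.1 h⟩, fun h => hxy.2 h.2⟩
      · simp only [l, hy, dif_neg, not_false_eq_true, LabelAdj, SimpleGraph.compl_adj]
        refine and_congr_right fun _ => iff_of_true (fun h => hy ⟨x, h.symm⟩) (by simp)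
    · simp only [l, hx, dif_neg, not_false_eq_true, LabelAdj, SimpleGraph.compl_adj]
      refine and_congr_right fun _ => iff_of_true (fun h => hx ⟨y, h⟩) (by simp)

variable {k : ℕ} {q p : Fin k → ℕ} {r : ℕ}

theorem completesWalks_of_iso (e : Gᶜ ≃g bipartiteUnionJoin q p r) : CompletesWalks G := by
  have hadj : ∀ x y, Gᶜ.Adj x y ↔ x ≠ y ∧ LabelAdj (label (e x)) (label (e y)) := fun x y => by
    rw [← e.map_adj_iff, bipartiteUnionJoin_adj, e.injective.ne_iff]
  -- Only isolated vertices of `G` correspond to vertices of `K_r`.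
  have hsome : ∀ x ∈ G.support, ∃ c, label (e x) = some c := by
    rintro x ⟨y, hxy⟩
    replace hxy : G.Adj x y := hxy
    refine Option.ne_none_iff_exists'.1 fun hx => ((hadj x y).2 ⟨hxy.ne, ?_⟩).2 hxy
    rw [hx]
    rintro a ⟨⟩
  intro a ha b hb c hc d hd hab hbc hcd
  rw [hadj] at hab hbc hcd ⊢
  obtain ⟨⟨ia, sa⟩, hla⟩ := hsome a ha
  obtain ⟨⟨ib, sb⟩, hlb⟩ := hsome b hb
  obtain ⟨⟨ic, sc⟩, hlc⟩ := hsome c hc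
  obtain ⟨⟨i₄, sd⟩, hld⟩ := hsome d hd
  obtain ⟨h1, h1'⟩ := hab.2 _ hla _ hlb
  obtain ⟨h2, h2'⟩ := hbc.2 _ hlb _ hlc
  obtain ⟨h3, h3'⟩ := hcd.2 _ hlc _ hld
  have hbool : ∀ s t u v : Bool, s ≠ t → t ≠ u → u ≠ v → s ≠ v := by decide
  have hs : sa ≠ sd := hbool _ _ _ _ h1' h2' h3'
  refine ⟨?_, ?_⟩
  · rintro rfl
    exact hs (congrArg Prod.snd (Option.some.inj (hla.symm.trans hld)))
  · rw [hla, hld]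
    rintro _ ⟨⟩ _ ⟨⟩
    exact ⟨h1.trans (h2.trans h3), hs⟩

/-- Under the conditions on the sizes, the two sides of the first complete bipartite graph contain
non-isolated vertices of `G`. -/
theorem exists_compl_adj_of_iso (e : Gᶜ ≃g bipartiteUnionJoin q p r) (hk : 1 ≤ k)
    (hqp : ∀ i, q i ≤ p i) (hp : ∀ i, 1 ≤ p i)
    (hq : 2 ≤ q ⟨0, hk⟩ ∨ (q ⟨0, hk⟩ = 1 ∧ 2 ≤ k)) :
    ∃ a ∈ G.support, ∃ b ∈ G.support, Gᶜ.Adj a b := by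
  have hsupp : ∀ u v, u ≠ v → ¬ LabelAdj (label u) (label v) → e.symm u ∈ G.support := by
    intro u v huv hl
    refine ⟨e.symm v, by_contra fun hn => hl ?_⟩
    have hc : Gᶜ.Adj (e.symm u) (e.symm v) := ⟨e.symm.injective.ne huv, hn⟩
    exact (bipartiteUnionJoin_adj.1 (e.symm.map_adj_iff.1 hc)).2
  have hedge : ∀ x y,
      Gᶜ.Adj (e.symm (.inl ⟨⟨0, hk⟩, .inl x⟩)) (e.symm (.inl ⟨⟨0, hk⟩, .inr y⟩)) :=
    fun x y => e.symm.map_adj_iff.2 (bipartiteUnionJoin_adj.2 ⟨by simp, by simp [label, LabelAdj]⟩)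
  rcases hq with hq | ⟨hq, hk2⟩
  · have hp2 := hq.trans (hqp _)
    refine ⟨_, hsupp (.inl ⟨⟨0, hk⟩, .inl ⟨0, by omega⟩⟩) (.inl ⟨⟨0, hk⟩, .inl ⟨1, by omega⟩⟩)
      (by simp) (by simp [label, LabelAdj]), _,
      hsupp (.inl ⟨⟨0, hk⟩, .inr ⟨0, by omega⟩⟩) (.inl ⟨⟨0, hk⟩, .inr ⟨1, by omega⟩⟩)
      (by simp) (by simp [label, LabelAdj]), hedge _ _⟩
  · refine ⟨_, hsupp (.inl ⟨⟨0, hk⟩, .inl ⟨0, by omega⟩⟩) (.inl ⟨⟨1, hk2⟩, .inr ⟨0, hp _⟩⟩)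
      (by simp) (by simp [label, LabelAdj]), _,
      hsupp (.inl ⟨⟨0, hk⟩, .inr ⟨0, hp _⟩⟩) (.inl ⟨⟨1, hk2⟩, .inr ⟨0, hp _⟩⟩)
      (by simp) (by simp [label, LabelAdj]), hedge _ _⟩

end Model

end ZeroForcing

theorem mainTheorem2 {V : Type*} [Fintype V] (G : SimpleGraph V) (hn : 3 ≤ Fintype.card V) :
    ZeroForcing.zir G = Fintype.card V - 2 ↔
      ∃ (k : ℕ) (hk : 1 ≤ k) (q p : Fin k → ℕ) (r : ℕ),
        (∀ i, q i ≤ p i) ∧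
        (∀ i j : Fin k, j.val = i.val + 1 → q j ≤ q i) ∧
        (∀ i, 1 ≤ p i) ∧
        (∀ i : Fin k, i.val + 2 = k → 1 ≤ q i) ∧
        (2 ≤ q ⟨0, hk⟩ ∨ (q ⟨0, hk⟩ = 1 ∧ 2 ≤ k)) ∧
        Nonempty (Gᶜ ≃g ZeroForcing.bipartiteUnionJoin q p r) := by
  rw [ZeroForcing.zir_eq_iff hn]
  constructor
  · rintro ⟨h, hE⟩
    exact h.exists_iso hE
  · rintro ⟨k, hk, q, p, r, hqp, -, hp, -, hq, ⟨e⟩⟩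
    exact ⟨ZeroForcing.completesWalks_of_iso e,
      ZeroForcing.exists_compl_adj_of_iso e hk hqp hp hq⟩
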